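/- Let $r \ge 2$ be an integer. For a (possibly empty or infinite) family $\mathcal F$ of finite $r$-uniform hypergraphs, let $\mathrm{ex}(n,\mathcal F)$ be the maximum number of edges of an $r$-uniform hypergraph on $n$ vertices that has no (not necessarily induced) subgraph isomorphic to a member of $\mathcal F$ (and $\mathrm{ex}(n,\mathcal F)=0$ if there is no such hypergraph), and let $\pi(\mathcal F)=\lim_{n\to\infty}\mathrm{ex}(n,\mathcal F)/\binom nr$ be its Turán density. Let $\Pi_\infty^{(r)}=\{\pi(\mathcal F) : \mathcal F \text{ a family of finite } r\text{-uniform hypergraphs}\}$ be the set of all Turán densities of such families. Then $$\mathfrak j(x)=\left(\frac{r-1}{r-x}\right)^{r-1}$$ defines a map $\mathfrak j:[0,1]\to[0,1]$, and $$\mathfrak j\bigl(\Pi_\infty^{(r)}\bigr)\subsetneq \Pi_\infty^{(r)},$$ that is, $\mathfrak j$ maps $\Pi_\infty^{(r)}$ into itself, and its image is a proper subset of $\Pi_\infty^{(r)}$. -/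

import Mathlib

/-- An `r`-uniform hypergraph (`r`-graph) with vertex set `V`: a finite collection of
`r`-element subsets of `V`. -/
structure UniformHypergraph (r : ℕ) (V : Type*) where
  edges : Finset (Finset V)
  card_of_mem_edges : ∀ e ∈ edges, e.card = r

namespace UniformHypergraph

/-- `F` is (isomorphic to) a subgraph, not necessarily induced, of `G`: there is an injective map
of the vertices that sends edges to edges. -/
def IsContained {r : ℕ} {V W : Type*} (F : UniformHypergraph r V) (G : UniformHypergraph r W) :
    Prop :=
  ∃ f : V ↪ W, ∀ e ∈ F.edges, e.map f ∈ G.edges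

/-- A (possibly empty, possibly infinite) family of finite `r`-graphs. Every finite `r`-graph is
isomorphic to one with vertex set `Fin m`, where `m` is its number of vertices. -/
abbrev Family (r : ℕ) : Type :=
  Set (Σ m : ℕ, UniformHypergraph r (Fin m))

/-- `G` is `𝓕`-free: no member of `𝓕` is a subgraph of `G`. -/
def IsFree {r : ℕ} {V : Type*} (𝓕 : Family r) (G : UniformHypergraph r V) : Prop :=
  ∀ F ∈ 𝓕, ¬ F.2.IsContained G

/-- The Turán function `ex(n, 𝓕)`: the maximum number of edges of an `𝓕`-free `r`-graph on `n`
vertices, and `0` if there is no such `r`-graph. -/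
noncomputable def extremalNumber {r : ℕ} (n : ℕ) (𝓕 : Family r) : ℕ :=
  sSup {k : ℕ | ∃ G : UniformHypergraph r (Fin n), IsFree 𝓕 G ∧ G.edges.card = k}

/-- `α` is the Turán density `π(𝓕)`, the limit of `ex(n, 𝓕) / (n choose r)`. -/
def IsTuranDensity {r : ℕ} (𝓕 : Family r) (α : ℝ) : Prop :=
  Filter.Tendsto (fun n : ℕ => (extremalNumber n 𝓕 : ℝ) / (n.choose r : ℝ))
    Filter.atTop (nhds α)

/-- The set of all Turán densities of families of `r`-graphs. -/
def turanDensities (r : ℕ) : Set ℝ :=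
  {α : ℝ | ∃ 𝓕 : Family r, IsTuranDensity 𝓕 α}

end UniformHypergraph

/-- The map `x ↦ ((r - 1) / (r - x)) ^ (r - 1)`, used for `r ≥ 2` and `0 ≤ x ≤ 1`. -/
noncomputable def rationalMap (r : ℕ) (x : ℝ) : ℝ :=
  (((r : ℝ) - 1) / ((r : ℝ) - x)) ^ (r - 1)

/-! ### Extremal numbers and containment. -/

namespace UniformHypergraph

/-! Write r = m + 1 and let `𝓕` have density α. Take an `𝓕`-free hypergraph on k of n vertices and
add all edges with exactly one vertex among the other n - k. Forbidding everything that embeds in no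
such construction gives a new family, and, as the class of constructions is hereditary up to losing
edges, its extremal number is governed by the maximum over k of ex(k, `𝓕`) + C(k, m)(n - k). With k
= sn the normalised count tends to α s^r + r(1 - s)s^(r-1), whose maximum over s is `rationalMap r
α`, attained at s = (r-1)/(r-α). Hence the image consists of Turán densities
(`IsTuranDensity.addIndependentFamily`). It is a proper subset because 0 is a Turán density while
`rationalMap` is positive on [0,1]. -/

open Finset in
theorem card_edges_le_choose {r n : ℕ} (G : UniformHypergraph r (Fin n)) :
    G.edges.card ≤ n.choose r := by
  have h : G.edges ⊆ powersetCard r univ := fun e he =>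
    mem_powersetCard.2 ⟨subset_univ _, G.card_of_mem_edges e he⟩
  simpa using card_le_card h

theorem bddAbove_card_edges_free {r : ℕ} (n : ℕ) (𝓕 : Family r) :
    BddAbove {k : ℕ | ∃ G : UniformHypergraph r (Fin n), IsFree 𝓕 G ∧ G.edges.card = k} :=
  ⟨n.choose r, by rintro k ⟨G, -, rfl⟩; exact G.card_edges_le_choose⟩

theorem IsFree.card_edges_le {r n : ℕ} {𝓕 : Family r} {G : UniformHypergraph r (Fin n)}
    (hG : IsFree 𝓕 G) : G.edges.card ≤ extremalNumber n 𝓕 :=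
  le_csSup (bddAbove_card_edges_free n 𝓕) ⟨G, hG, rfl⟩

theorem extremalNumber_le_of_forall {r n N : ℕ} {𝓕 : Family r}
    (h : ∀ G : UniformHypergraph r (Fin n), IsFree 𝓕 G → G.edges.card ≤ N) :
    extremalNumber n 𝓕 ≤ N := by
  rcases Set.eq_empty_or_nonempty
    {k : ℕ | ∃ G : UniformHypergraph r (Fin n), IsFree 𝓕 G ∧ G.edges.card = k} with h0 | h0
  · rw [extremalNumber, h0]; simp
  · refine csSup_le h0 ?_
    rintro k ⟨G, hG, rfl⟩
    exact h G hG

theorem extremalNumber_le_choose {r : ℕ} (n : ℕ) (𝓕 : Family r) :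
    extremalNumber n 𝓕 ≤ n.choose r :=
  extremalNumber_le_of_forall fun G _ => G.card_edges_le_choose

theorem exists_isFree_card_edges_eq {r n : ℕ} {𝓕 : Family r}
    (h : ∃ G : UniformHypergraph r (Fin n), IsFree 𝓕 G) :
    ∃ G : UniformHypergraph r (Fin n), IsFree 𝓕 G ∧ G.edges.card = extremalNumber n 𝓕 := by
  obtain ⟨G, hG⟩ := h
  have hne : {k : ℕ | ∃ G : UniformHypergraph r (Fin n), IsFree 𝓕 G ∧ G.edges.card = k}.Nonempty :=
    ⟨_, G, hG, rfl⟩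
  exact Nat.sSup_mem hne (bddAbove_card_edges_free n 𝓕)

theorem IsContained.refl {r : ℕ} {V : Type*} (G : UniformHypergraph r V) : G.IsContained G :=
  ⟨Function.Embedding.refl V, fun e he => by simpa using he⟩

theorem IsContained.trans {r : ℕ} {U V W : Type*} {F : UniformHypergraph r U}
    {G : UniformHypergraph r V} {H : UniformHypergraph r W}
    (hFG : F.IsContained G) (hGH : G.IsContained H) : F.IsContained H := by
  obtain ⟨f, hf⟩ := hFG
  obtain ⟨g, hg⟩ := hGH
  exact ⟨f.trans g, fun e he => by simpa [Finset.map_map] using hg _ (hf e he)⟩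

theorem IsFree.of_isContained {r : ℕ} {V W : Type*} {𝓕 : Family r} {G : UniformHypergraph r V}
    {H : UniformHypergraph r W} (hH : IsFree 𝓕 H) (hGH : G.IsContained H) : IsFree 𝓕 G :=
  fun F hF h => hH F hF (h.trans hGH)

/-! ### The construction and its extremal number. -/

/-- The image of a hypergraph under an injective map of its vertices. -/
def mapVertices {r : ℕ} {V W : Type*} (f : V ↪ W) (G : UniformHypergraph r V) :
    UniformHypergraph r W where
  edges := G.edges.map (Finset.mapEmbedding f).toEmbedding
  card_of_mem_edges := by
    intro e he
    obtain ⟨e', he', rfl⟩ := Finset.mem_map.1 he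
    simpa using G.card_of_mem_edges e' he'

theorem mapVertices_equiv_isContained {r : ℕ} {V W : Type*} (f : V ≃ W)
    (G : UniformHypergraph r V) : (G.mapVertices f.toEmbedding).IsContained G := by
  refine ⟨f.symm.toEmbedding, fun e he => ?_⟩
  obtain ⟨e', he', rfl⟩ := Finset.mem_map.1 he
  simpa [Finset.map_map] using he'

/-- The hypergraph obtained from `H` by adding `b` new vertices and all edges that consist of
one new vertex and `m` old vertices. -/
def addIndependent {m a : ℕ} (H : UniformHypergraph (m + 1) (Fin a)) (b : ℕ) :
    UniformHypergraph (m + 1) (Fin a ⊕ Fin b) where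
  edges := H.edges.image (fun e => e.disjSum ∅) ∪
    (Finset.powersetCard m Finset.univ ×ˢ Finset.univ).image
      (fun p : Finset (Fin a) × Fin b => p.1.disjSum {p.2})
  card_of_mem_edges := by
    intro e he
    rcases Finset.mem_union.1 he with he | he
    · obtain ⟨e', he', rfl⟩ := Finset.mem_image.1 he
      simpa using H.card_of_mem_edges e' he'
    · obtain ⟨⟨s, y⟩, hp, rfl⟩ := Finset.mem_image.1 he
      have := (Finset.mem_powersetCard.1 (Finset.mem_product.1 hp).1).2
      simpa using this

theorem card_edges_addIndependent {m a : ℕ} (H : UniformHypergraph (m + 1) (Fin a)) (b : ℕ) :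
    (H.addIndependent b).edges.card = H.edges.card + a.choose m * b := by
  have hinl : ∀ (s s' : Finset (Fin a)) (t t' : Finset (Fin b)),
      s.disjSum t = s'.disjSum t' → s = s' ∧ t = t' := by
    intro s s' t t' h
    constructor
    · ext x; simpa using Finset.ext_iff.1 h (Sum.inl x)
    · ext x; simpa using Finset.ext_iff.1 h (Sum.inr x)
  rw [addIndependent, Finset.card_union_of_disjoint, Finset.card_image_of_injective,
    Finset.card_image_of_injective]
  · simp
  · rintro ⟨s, y⟩ ⟨s', y'⟩ h
    obtain ⟨h1, h2⟩ := hinl _ _ _ _ h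
    simp only [Prod.mk.injEq]
    exact ⟨h1, Finset.singleton_injective h2⟩
  · intro s s' h
    exact (hinl _ _ _ _ h).1
  · rw [Finset.disjoint_left]
    intro e he he'
    obtain ⟨s, -, rfl⟩ := Finset.mem_image.1 he
    obtain ⟨⟨s', y⟩, -, h⟩ := Finset.mem_image.1 he'
    have := (hinl _ _ _ _ h).2
    simp at this

/-- The hypergraphs that are not contained in any `H.addIndependent b` with `H` free of `𝓕`. -/
def addIndependentFamily {m : ℕ} (𝓕 : Family (m + 1)) : Family (m + 1) :=
  {F | ∀ (a b : ℕ) (H : UniformHypergraph (m + 1) (Fin a)), IsFree 𝓕 H →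
    ¬ F.2.IsContained (H.addIndependent b)}

theorem le_extremalNumber_addIndependentFamily {m a b : ℕ} {𝓕 : Family (m + 1)}
    (h : ∃ G : UniformHypergraph (m + 1) (Fin a), IsFree 𝓕 G) :
    extremalNumber a 𝓕 + a.choose m * b ≤ extremalNumber (a + b) (addIndependentFamily 𝓕) := by
  obtain ⟨H, hH, hcard⟩ := exists_isFree_card_edges_eq h
  have hfree : IsFree (addIndependentFamily 𝓕)
      ((H.addIndependent b).mapVertices finSumFinEquiv.toEmbedding) :=
    fun F hF hc => hF a b H hH (hc.trans (mapVertices_equiv_isContained _ _))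
  have := hfree.card_edges_le
  simpa [mapVertices, card_edges_addIndependent, hcard] using this

-- Here k counts the vertices of `G` sent to the `H` side. They induce an `𝓕`-free hypergraph, and
-- every other edge has exactly one vertex outside.
open Finset in
theorem exists_card_edges_le_of_isContained_addIndependent {m n a b : ℕ} {𝓕 : Family (m + 1)}
    {H : UniformHypergraph (m + 1) (Fin a)} (hH : IsFree 𝓕 H)
    {G : UniformHypergraph (m + 1) (Fin n)} (hG : G.IsContained (H.addIndependent b)) :
    ∃ k ≤ n, G.edges.card ≤ extremalNumber k 𝓕 + k.choose m * (n - k) := by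
  classical
  obtain ⟨f, hf⟩ := hG
  set A : Finset (Fin n) := univ.filter fun v => (f v).isLeft with hA
  let ι : Fin A.card ↪ Fin n := (A.orderEmbOfFin rfl).toEmbedding
  have hι : ∀ i, (f (ι i)).isLeft = true := fun i => by
    exact (mem_filter.1 (A.orderEmbOfFin_mem rfl i)).2
  have hιsurj : ∀ v ∈ A, ∃ i, ι i = v := fun v hv => by
    have : v ∈ Set.range (A.orderEmbOfFin rfl) := by simpa using hv
    exact this
  let H' : UniformHypergraph (m + 1) (Fin A.card) :=
    { edges := univ.filter fun e => e.map ι ∈ G.edges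
      card_of_mem_edges := fun e he => by
        simpa using G.card_of_mem_edges _ (mem_filter.1 he).2 }
  let g : Fin A.card ↪ Fin a :=
    ⟨fun i => (f (ι i)).getLeft (hι i), fun i j hij => by
      apply ι.injective
      apply f.injective
      rw [← Sum.inl_getLeft (f (ι i)) (hι i), ← Sum.inl_getLeft (f (ι j)) (hι j)]
      exact congrArg _ hij⟩
  have hg : ∀ i, f (ι i) = Sum.inl (g i) := fun i => (Sum.inl_getLeft _ (hι i)).symm
  have hH' : IsFree 𝓕 H' := by
    refine hH.of_isContained ⟨g, fun e he => ?_⟩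
    have he' : (e.map ι).map f ∈ (H.addIndependent b).edges := hf _ (mem_filter.1 he).2
    have hmap : (e.map ι).map f = (e.map g).disjSum ∅ := by
      ext x
      cases x <;> simp [hg]
    rw [hmap] at he'
    rcases mem_union.1 he' with h | h
    · obtain ⟨s, hs, h⟩ := mem_image.1 h
      have : s = e.map g := by ext x; simpa using Finset.ext_iff.1 h (Sum.inl x)
      exact this ▸ hs
    · obtain ⟨⟨s, y⟩, -, h⟩ := mem_image.1 h
      have := Finset.ext_iff.1 h (Sum.inr y)
      simp at this
  refine ⟨A.card, by simpa using card_le_univ A, ?_⟩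
  have hsub : G.edges ⊆ H'.edges.image (fun e => e.map ι) ∪
      (powersetCard m A ×ˢ Aᶜ).image (fun p => insert p.2 p.1) := by
    intro e he
    rcases mem_union.1 (hf e he) with h | h
    · obtain ⟨s, -, h⟩ := mem_image.1 h
      have heA : ∀ v ∈ e, v ∈ A := by
        intro v hv
        have hv' : f v ∈ s.disjSum (∅ : Finset (Fin b)) := h ▸ mem_map_of_mem f hv
        rcases hfv : f v with x | x
        · simp [hA, hfv]
        · simp [hfv] at hv'
      have hpre : (univ.filter fun i => ι i ∈ e).map ι = e := by
        ext v
        simp only [mem_map, mem_filter, mem_univ, true_and]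
        constructor
        · rintro ⟨i, hi, rfl⟩; exact hi
        · intro hv
          obtain ⟨i, rfl⟩ := hιsurj v (heA v hv)
          exact ⟨i, hv, rfl⟩
      exact mem_union_left _ (mem_image.2
        ⟨_, mem_filter.2 ⟨mem_univ _, by rw [hpre]; exact he⟩, hpre⟩)
    · obtain ⟨⟨s, y⟩, -, h⟩ := mem_image.1 h
      have hy : Sum.inr y ∈ e.map f := by rw [← h]; simp
      obtain ⟨v, hv, hfv⟩ := mem_map.1 hy
      refine mem_union_right _ (mem_image.2 ⟨(e.erase v, v), ?_, insert_erase hv⟩)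
      simp only [mem_product, mem_powersetCard, mem_compl]
      refine ⟨⟨fun w hw => ?_, ?_⟩, by simp [hA, hfv]⟩
      · obtain ⟨hwv, hw⟩ := mem_erase.1 hw
        have hw' : f w ∈ s.disjSum {y} := h ▸ mem_map_of_mem f hw
        rcases hfw : f w with x | x
        · simp [hA, hfw]
        · rw [hfw] at hw'
          have : x = y := by simpa using hw'
          exact absurd (f.injective (by rw [hfw, hfv, this])) hwv
      · rw [card_erase_of_mem hv, G.card_of_mem_edges e he]; rfl
  calc G.edges.card ≤ _ := card_le_card hsub
    _ ≤ _ := card_union_le _ _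
    _ ≤ _ := by
      refine Nat.add_le_add (card_image_le.trans hH'.card_edges_le) (card_image_le.trans ?_)
      simp [card_compl]

theorem exists_extremalNumber_addIndependentFamily_le {m : ℕ} (𝓕 : Family (m + 1)) (n : ℕ) :
    ∃ k ≤ n, extremalNumber n (addIndependentFamily 𝓕) ≤
      extremalNumber k 𝓕 + k.choose m * (n - k) := by
  by_cases h : ∃ G : UniformHypergraph (m + 1) (Fin n), IsFree (addIndependentFamily 𝓕) G
  · obtain ⟨G, hG, hcard⟩ := exists_isFree_card_edges_eq h
    -- `G` contains itself, so it is not forbidden and must embed in some construction.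
    have hmem : (⟨n, G⟩ : Σ k : ℕ, UniformHypergraph (m + 1) (Fin k)) ∉ addIndependentFamily 𝓕 :=
      fun hF => hG _ hF (IsContained.refl G)
    simp only [addIndependentFamily, Set.mem_ofPred_eq, not_forall, not_not] at hmem
    obtain ⟨a, b, H, hH, hc⟩ := hmem
    rw [← hcard]
    exact exists_card_edges_le_of_isContained_addIndependent hH hc
  · refine ⟨0, n.zero_le, (extremalNumber_le_of_forall (N := 0) fun G hG => ?_).trans
      (Nat.zero_le _)⟩
    exact absurd ⟨G, hG⟩ h

/-! ### Density zero and families that forbid everything. -/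

/-- The family of all hypergraphs that have an edge. -/
def nonemptyFamily (r : ℕ) : Family r := {F | F.2.edges.Nonempty}

theorem isFree_nonemptyFamily_iff {r n : ℕ} {G : UniformHypergraph r (Fin n)} :
    IsFree (nonemptyFamily r) G ↔ G.edges = ∅ := by
  constructor
  · intro h
    by_contra hne
    exact h ⟨n, G⟩ (Finset.nonempty_iff_ne_empty.2 hne) (IsContained.refl G)
  · rintro h F ⟨e, he⟩ ⟨f, hf⟩
    simpa [h] using hf e he

theorem isTuranDensity_nonemptyFamily (r : ℕ) : IsTuranDensity (nonemptyFamily r) 0 := by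
  have h : ∀ n, extremalNumber n (nonemptyFamily r) = 0 := fun n =>
    Nat.le_zero.1 <| extremalNumber_le_of_forall fun G hG => by
      simp [isFree_nonemptyFamily_iff.1 hG]
  simp [IsTuranDensity, h]

/-- The hypergraph without edges. -/
def edgeless (r : ℕ) (V : Type*) : UniformHypergraph r V := ⟨∅, by simp⟩

/-- The lower bound needs a free hypergraph of every order. If none exists on N vertices, none
exists on more, so the default value 0 of the extremal number forces α = 0 and `nonemptyFamily` can
replace `𝓕`. -/
theorem exists_isTuranDensity_forall_exists_isFree {r : ℕ} {α : ℝ}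
    (hα : α ∈ turanDensities r) :
    ∃ 𝓕 : Family r, IsTuranDensity 𝓕 α ∧
      ∀ n, ∃ G : UniformHypergraph r (Fin n), IsFree 𝓕 G := by
  obtain ⟨𝓕, h𝓕⟩ := hα
  by_cases h : ∀ n, ∃ G : UniformHypergraph r (Fin n), IsFree 𝓕 G
  · exact ⟨𝓕, h𝓕, h⟩
  push Not at h
  obtain ⟨N, hN⟩ := h
  have hzero : ∀ n, N ≤ n → extremalNumber n 𝓕 = 0 := by
    intro n hn
    refine Nat.le_zero.1 (extremalNumber_le_of_forall fun G hG => ?_)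
    refine absurd (hG.of_isContained ⟨Fin.castLEEmb hn, ?_⟩) (hN (edgeless r (Fin N)))
    simp [edgeless]
  have : α = 0 := by
    refine tendsto_nhds_unique h𝓕 (tendsto_const_nhds.congr' ?_)
    filter_upwards [Filter.eventually_ge_atTop N] with n hn
    simp [hzero n hn]
  subst this
  exact ⟨nonemptyFamily r, isTuranDensity_nonemptyFamily r, fun n =>
    ⟨edgeless r _, isFree_nonemptyFamily_iff.2 rfl⟩⟩

theorem turanDensities_subset_Icc (r : ℕ) : turanDensities r ⊆ Set.Icc 0 1 := by
  rintro α ⟨𝓕, h𝓕⟩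
  refine isClosed_Icc.mem_of_tendsto h𝓕 (Filter.Eventually.of_forall fun n => ⟨by positivity, ?_⟩)
  exact div_le_one_of_le₀ (by exact_mod_cast extremalNumber_le_choose n 𝓕) (by positivity)

end UniformHypergraph

/-! ### The one-variable optimisation. -/

open Filter Topology in
theorem tendsto_choose_div_pow (k : ℕ) :
    Tendsto (fun n : ℕ => (n.choose k : ℝ) / (n : ℝ) ^ k) atTop (𝓝 (1 / k.factorial)) := by
  have hk : (k.factorial : ℝ) ≠ 0 := by positivity
  have h := (Asymptotics.isEquivalent_iff_tendsto_one (by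
    filter_upwards [eventually_gt_atTop 0] with n hn
    positivity)).1 (isEquivalent_choose k)
  refine (h.div_const (k.factorial : ℝ)).congr' ?_
  filter_upwards [eventually_gt_atTop 0] with n hn
  simp only [Pi.div_apply]
  field_simp

/-- AM-GM for 1 and m copies of u^(m+1). -/
theorem succ_mul_pow_le_one_add (m : ℕ) {u : ℝ} (hu : 0 ≤ u) :
    ((m : ℝ) + 1) * u ^ m ≤ 1 + m * u ^ (m + 1) := by
  induction m with
  | zero => simp
  | succ m ih =>
    have h : 0 ≤ ((m : ℝ) + 1) * u ^ m * (u - 1) ^ 2 := by positivity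
    push_cast
    have key : 1 + ((m : ℝ) + 1) * u ^ (m + 1 + 1) - (m + 1 + 1) * u ^ (m + 1) =
        1 + m * u ^ (m + 1) - (m + 1) * u ^ m + (m + 1) * u ^ m * (u - 1) ^ 2 := by ring
    linarith

theorem rationalMap_succ (m : ℕ) (x : ℝ) :
    rationalMap (m + 1) x = ((m : ℝ) / (m + 1 - x)) ^ m := by
  simp [rationalMap]

theorem add_mul_le_rationalMap {m : ℕ} (hm : 1 ≤ m) {x s : ℝ} (hx : x ≤ 1) (hs : 0 ≤ s) :
    x * s ^ (m + 1) + (m + 1) * (1 - s) * s ^ m ≤ rationalMap (m + 1) x := by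
  have hm' : (1 : ℝ) ≤ m := by exact_mod_cast hm
  have hd : 0 < (m : ℝ) + 1 - x := by linarith
  rw [rationalMap_succ]
  set c := (m : ℝ) / (m + 1 - x) with hc
  have hcpos : 0 < c := by positivity
  have hcd : c * (m + 1 - x) = m := by rw [hc]; field_simp
  -- c is the maximiser; rescaling puts it at u = 1, the equality case of the AM-GM bound.
  obtain ⟨u, rfl⟩ : ∃ u, s = c * u := ⟨s / c, by field_simp⟩
  have hu : 0 ≤ u := nonneg_of_mul_nonneg_right hs hcpos
  have h := mul_le_mul_of_nonneg_left (succ_mul_pow_le_one_add m hu) (pow_nonneg hcpos.le m)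
  calc x * (c * u) ^ (m + 1) + (m + 1) * (1 - c * u) * (c * u) ^ m
      = c ^ m * ((m + 1) * u ^ m) - c ^ m * u ^ (m + 1) * (c * (m + 1 - x)) := by ring
    _ ≤ c ^ m := by rw [hcd]; linarith

theorem add_mul_eq_rationalMap {m : ℕ} (hm : 1 ≤ m) {x : ℝ} (hx : x ≤ 1) :
    x * ((m : ℝ) / (m + 1 - x)) ^ (m + 1) +
      (m + 1) * (1 - (m : ℝ) / (m + 1 - x)) * ((m : ℝ) / (m + 1 - x)) ^ m =
        rationalMap (m + 1) x := by
  have hm' : (1 : ℝ) ≤ m := by exact_mod_cast hm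
  have hd : (m : ℝ) + 1 - x ≠ 0 := by linarith
  rw [rationalMap_succ]
  set c := (m : ℝ) / (m + 1 - x) with hc
  have hcd : c * (m + 1 - x) = m := by rw [hc]; field_simp
  linear_combination (-c ^ m) * hcd

theorem mapsTo_rationalMap {m : ℕ} (hm : 1 ≤ m) :
    Set.MapsTo (rationalMap (m + 1)) (Set.Icc 0 1) (Set.Icc 0 1) := by
  rintro x ⟨-, hx⟩
  have hm' : (1 : ℝ) ≤ m := by exact_mod_cast hm
  have hd : 0 < (m : ℝ) + 1 - x := by linarith
  rw [rationalMap_succ]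
  exact ⟨by positivity, pow_le_one₀ (by positivity) ((div_le_one hd).2 (by linarith))⟩

theorem rationalMap_pos {m : ℕ} (hm : 1 ≤ m) {x : ℝ} (hx : x ≤ 1) :
    0 < rationalMap (m + 1) x := by
  have hm' : (1 : ℝ) ≤ m := by exact_mod_cast hm
  have hd : 0 < (m : ℝ) + 1 - x := by linarith
  rw [rationalMap_succ]
  positivity

/-! ### Passage to the limit. -/

namespace UniformHypergraph

open Filter Topology

theorem isTuranDensity_iff_tendsto_div_pow {r : ℕ} {𝓕 : Family r} {α : ℝ} :
    IsTuranDensity 𝓕 α ↔ Tendsto (fun n : ℕ => (extremalNumber n 𝓕 : ℝ) / (n : ℝ) ^ r) atTop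
      (𝓝 (α / r.factorial)) := by
  have hr : (r.factorial : ℝ) ≠ 0 := by positivity
  have hc := tendsto_choose_div_pow r
  constructor
  · intro h
    rw [div_eq_mul_one_div]
    refine (Tendsto.mul h hc).congr' ?_
    filter_upwards [eventually_gt_atTop 0, eventually_ge_atTop r] with n hn hnr
    have : (n.choose r : ℝ) ≠ 0 := by exact_mod_cast (Nat.choose_pos hnr).ne'
    field_simp
  · intro h
    have h' := h.div hc (by positivity)
    rw [div_div_div_cancel_right₀ hr, div_one] at h'
    refine h'.congr' ?_
    filter_upwards [eventually_gt_atTop 0, eventually_ge_atTop r] with n hn hnr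
    have : (n.choose r : ℝ) ≠ 0 := by exact_mod_cast (Nat.choose_pos hnr).ne'
    simp only [Pi.div_apply]
    field_simp

/-- The constant K absorbs small n, making the bound uniform. This matters because it is applied to
a k that need not grow with n. -/
theorem IsTuranDensity.exists_factorial_mul_extremalNumber_le {r : ℕ} {𝓕 : Family r} {α : ℝ}
    (h : IsTuranDensity 𝓕 α) {ε : ℝ} (hε : 0 < ε) :
    ∃ K : ℝ, ∀ n : ℕ, r.factorial * (extremalNumber n 𝓕 : ℝ) ≤ (α + ε) * (n : ℝ) ^ r + K := by
  have hr : (0 : ℝ) < r.factorial := by positivity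
  have hev := (isTuranDensity_iff_tendsto_div_pow.1 h).eventually
    (gt_mem_nhds (show α / r.factorial < (α + ε) / r.factorial by gcongr; linarith))
  obtain ⟨N, hN⟩ := eventually_atTop.1 (hev.and (eventually_gt_atTop 0))
  have hα : 0 ≤ α := (turanDensities_subset_Icc r ⟨𝓕, h⟩).1
  refine ⟨r.factorial * (N.choose r : ℝ), fun n => ?_⟩
  rcases le_total N n with hn | hn
  · obtain ⟨h1, h2⟩ := hN n hn
    have h2' : (0 : ℝ) < (n : ℝ) ^ r := by positivity
    rw [div_lt_div_iff₀ h2' hr] at h1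
    have : (0 : ℝ) ≤ r.factorial * (N.choose r : ℝ) := by positivity
    linarith
  · have h1 : (extremalNumber n 𝓕 : ℝ) ≤ N.choose r := by
      exact_mod_cast (extremalNumber_le_choose n 𝓕).trans (Nat.choose_le_choose r hn)
    have h2 : 0 ≤ (α + ε) * (n : ℝ) ^ r := by positivity
    have := mul_le_mul_of_nonneg_left h1 hr.le
    linarith

theorem IsTuranDensity.exists_extremalNumber_addIndependentFamily_le {m : ℕ} (hm : 1 ≤ m)
    {𝓕 : Family (m + 1)} {α : ℝ} (h : IsTuranDensity 𝓕 α) {ε : ℝ} (hε : 0 < ε) :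
    ∃ K : ℝ, ∀ n : ℕ, ((m + 1).factorial : ℝ) * extremalNumber n (addIndependentFamily 𝓕) ≤
      (rationalMap (m + 1) α + ε) * (n : ℝ) ^ (m + 1) + K := by
  obtain ⟨K, hK⟩ := h.exists_factorial_mul_extremalNumber_le hε
  refine ⟨K, fun n => ?_⟩
  have hα := (turanDensities_subset_Icc _ ⟨𝓕, h⟩).2
  obtain ⟨k, hk, hle⟩ := UniformHypergraph.exists_extremalNumber_addIndependentFamily_le 𝓕 n
  have hkn : (k : ℝ) ≤ n := by exact_mod_cast hk
  have hle' : (extremalNumber n (addIndependentFamily 𝓕) : ℝ) ≤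
      extremalNumber k 𝓕 + k.choose m * (n - k) := by
    have : ((extremalNumber n (addIndependentFamily 𝓕) : ℕ) : ℝ) ≤
      ((extremalNumber k 𝓕 + k.choose m * (n - k) : ℕ) : ℝ) := by exact_mod_cast hle
    rwa [Nat.cast_add, Nat.cast_mul, Nat.cast_sub hk] at this
  have hchoose : (m.factorial : ℝ) * k.choose m ≤ (k : ℝ) ^ m := by
    have := Nat.descFactorial_le_pow k m
    rw [Nat.descFactorial_eq_factorial_mul_choose] at this
    exact_mod_cast this
  have hpow : (k : ℝ) ^ (m + 1) ≤ (n : ℝ) ^ (m + 1) := by gcongr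
  have hmax : α * (k : ℝ) ^ (m + 1) + (m + 1) * (n - k) * (k : ℝ) ^ m ≤
      rationalMap (m + 1) α * (n : ℝ) ^ (m + 1) := by
    rcases Nat.eq_zero_or_pos n with rfl | hn
    · obtain rfl : k = 0 := by omega
      simp
    · have hn' : (0 : ℝ) < n := by exact_mod_cast hn
      have := mul_le_mul_of_nonneg_right
        (add_mul_le_rationalMap hm hα (show (0 : ℝ) ≤ k / n by positivity))
        (show (0 : ℝ) ≤ (n : ℝ) ^ (m + 1) by positivity)
      refine le_of_eq_of_le ?_ this
      rw [div_pow, div_pow]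
      field_simp
      ring
  calc ((m + 1).factorial : ℝ) * extremalNumber n (addIndependentFamily 𝓕)
      ≤ (m + 1).factorial * (extremalNumber k 𝓕 + k.choose m * (n - k)) := by gcongr
    _ = (m + 1).factorial * extremalNumber k 𝓕 +
        (m + 1) * (n - k) * (m.factorial * k.choose m) := by
      rw [Nat.factorial_succ]; push_cast; ring
    _ ≤ ((α + ε) * (k : ℝ) ^ (m + 1) + K) + (m + 1) * (n - k) * (k : ℝ) ^ m := by
      have : (0 : ℝ) ≤ (m + 1) * (n - k) := mul_nonneg (by positivity) (by linarith)
      exact add_le_add (hK k) (mul_le_mul_of_nonneg_left hchoose this)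
    _ ≤ _ := by nlinarith [mul_le_mul_of_nonneg_left hpow hε.le]

theorem IsTuranDensity.addIndependentFamily {m : ℕ} (hm : 1 ≤ m) {𝓕 : Family (m + 1)} {α : ℝ}
    (h : IsTuranDensity 𝓕 α) (hfree : ∀ n, ∃ G : UniformHypergraph (m + 1) (Fin n), IsFree 𝓕 G) :
    IsTuranDensity (addIndependentFamily 𝓕) (rationalMap (m + 1) α) := by
  have hα := turanDensities_subset_Icc _ ⟨𝓕, h⟩
  have hm' : (1 : ℝ) ≤ m := by exact_mod_cast hm
  have hd : 0 < (m : ℝ) + 1 - α := by linarith [hα.2]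
  have hF : (0 : ℝ) < (m + 1).factorial := by positivity
  rw [isTuranDensity_iff_tendsto_div_pow]
  -- The optimal proportion; the lower bound uses k = ⌊s n⌋.
  set s : ℝ := (m : ℝ) / (m + 1 - α) with hs
  have hs0 : 0 < s := by positivity
  have hs1 : s ≤ 1 := (div_le_one hd).2 (by linarith [hα.2])
  have hfloor : Tendsto (fun n : ℕ => ⌊s * n⌋₊) atTop atTop := tendsto_nat_floor_mul_atTop s hs0
  have hratio : Tendsto (fun n : ℕ => (⌊s * n⌋₊ : ℝ) / n) atTop (𝓝 s) :=
    (tendsto_nat_floor_mul_div_atTop hs0.le).comp tendsto_natCast_atTop_atTop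
  have hlower := (((isTuranDensity_iff_tendsto_div_pow.1 h).comp hfloor).mul
    (hratio.pow (m + 1))).add
      ((((tendsto_choose_div_pow m).comp hfloor).mul (hratio.pow m)).mul (hratio.const_sub 1))
  have hlim : α / (m + 1).factorial * s ^ (m + 1) + 1 / m.factorial * s ^ m * (1 - s) =
      rationalMap (m + 1) α / (m + 1).factorial := by
    rw [← add_mul_eq_rationalMap hm hα.2, ← hs, Nat.factorial_succ]
    push_cast
    have : (m.factorial : ℝ) ≠ 0 := by positivity
    field_simp
  rw [hlim] at hlower
  rw [tendsto_order]
  constructor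
  · intro x hx
    filter_upwards [hlower.eventually (lt_mem_nhds hx), eventually_gt_atTop 0,
      hfloor.eventually (eventually_gt_atTop 0)] with n hn hn0 hk0
    refine hn.trans_le ?_
    simp only [Function.comp_apply]
    set k := ⌊s * n⌋₊ with hk
    have hn0' : (0 : ℝ) < n := by exact_mod_cast hn0
    have hk0' : (0 : ℝ) < k := by exact_mod_cast hk0
    have hkn : k ≤ n := by
      refine Nat.floor_le_of_le ?_
      nlinarith
    have hle := le_extremalNumber_addIndependentFamily (b := n - k) (hfree k)
    rw [Nat.add_sub_cancel' hkn] at hle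
    have hle' : (extremalNumber k 𝓕 : ℝ) + k.choose m * (n - k) ≤
        extremalNumber n (UniformHypergraph.addIndependentFamily 𝓕) := by
      rw [← Nat.cast_sub hkn]
      exact_mod_cast hle
    rw [le_div_iff₀ (by positivity)]
    refine le_trans (le_of_eq ?_) hle'
    rw [div_pow, div_pow]
    field_simp
    ring
  · intro x hx
    obtain ⟨ε, hε, hεx⟩ : ∃ ε > 0, (rationalMap (m + 1) α + ε) / (m + 1).factorial < x := by
      -- Half of the slack, leaving room for the vanishing K term.
      refine ⟨(x * (m + 1).factorial - rationalMap (m + 1) α) / 2, ?_, ?_⟩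
      · rw [gt_iff_lt, div_lt_iff₀ hF] at hx
        linarith
      · rw [gt_iff_lt, div_lt_iff₀ hF] at hx
        rw [div_lt_iff₀ hF]
        linarith
    obtain ⟨K, hK⟩ := h.exists_extremalNumber_addIndependentFamily_le hm hε
    have hKlim : Tendsto (fun n : ℕ => (rationalMap (m + 1) α + ε) / (m + 1).factorial +
        K / (m + 1).factorial / (n : ℝ) ^ (m + 1)) atTop
        (𝓝 ((rationalMap (m + 1) α + ε) / (m + 1).factorial + 0)) :=
      tendsto_const_nhds.add (tendsto_const_nhds.div_atTop
        ((tendsto_pow_atTop (Nat.succ_ne_zero m)).comp tendsto_natCast_atTop_atTop))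
    rw [add_zero] at hKlim
    filter_upwards [hKlim.eventually (gt_mem_nhds hεx), eventually_gt_atTop 0] with n hn hn0
    refine lt_of_le_of_lt ?_ hn
    have hn0' : (0 : ℝ) < n := by exact_mod_cast hn0
    have := hK n
    rw [div_le_iff₀ (by positivity), ← mul_le_mul_iff_right₀ hF]
    refine this.trans (le_of_eq ?_)
    field_simp

end UniformHypergraph

theorem mainTheorem7 (r : ℕ) (hr : 2 ≤ r) :
    Set.MapsTo (rationalMap r) (Set.Icc 0 1) (Set.Icc 0 1) ∧
      rationalMap r '' UniformHypergraph.turanDensities r ⊂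
        UniformHypergraph.turanDensities r := by
  obtain ⟨m, rfl⟩ : ∃ m, r = m + 1 := ⟨r - 1, by omega⟩
  have hm : 1 ≤ m := by omega
  refine ⟨mapsTo_rationalMap hm, Set.ssubset_iff_subset_ne.2 ⟨?_, fun heq => ?_⟩⟩
  · rintro _ ⟨α, hα, rfl⟩
    obtain ⟨𝓕, h𝓕, hfree⟩ :=
      UniformHypergraph.exists_isTuranDensity_forall_exists_isFree hα
    exact ⟨_, h𝓕.addIndependentFamily hm hfree⟩
  · have h0 : (0 : ℝ) ∈ UniformHypergraph.turanDensities (m + 1) :=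
      ⟨_, UniformHypergraph.isTuranDensity_nonemptyFamily (m + 1)⟩
    rw [← heq] at h0
    obtain ⟨α, hα, h⟩ := h0
    exact (rationalMap_pos hm (UniformHypergraph.turanDensities_subset_Icc _ hα).2).ne' h
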